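/- Let $K\ge 1$ and $\sigma>0$. For $\alpha\in\mathbb{R}$ let $g(\alpha)\in\mathbb{R}^{2K\times 2K}$ be the block-diagonal matrix whose $k$-th block ($k=1,\dots,K$) is $$\begin{pmatrix}\cos k\alpha & -\sin k\alpha\\ \sin k\alpha & \cos k\alpha\end{pmatrix}.$$ For $\theta=(\theta_{1,1},\theta_{1,2},\dots,\theta_{K,1},\theta_{K,2})\in\mathbb{R}^{2K}$ let $p_\theta$ be the density of $y=g(\alpha)\theta+\sigma\varepsilon$, where $\alpha\sim\mathrm{Unif}([-\pi,\pi))$ and $\varepsilon\sim\mathcal{N}(0,I_{2K})$ are independent, i.e. $$p_\theta(y)=\frac{1}{2\pi}\int_{-\pi}^{\pi}\frac{1}{(2\pi\sigma^2)^{K}}\exp\Big(-\frac{\|y-g(\alpha)\theta\|^2}{2\sigma^2}\Big)\,d\alpha ,$$ and let $D_{\mathrm{KL}}(p\|q)=\int p\log(p/q)$. Then for all $\theta,\theta'\in\mathbb{R}^{2K}$, $$D_{\mathrm{KL}}(p_\theta\|p_{\theta'})\le\frac{\|\theta-\theta'\|^2}{2\sigma^2}.$$ Furthermore, write $(\theta_{k,1},\theta_{k,2})=(r_k\cos\phi_k,r_k\sin\phi_k)$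 and $(\theta'_{k,1},\theta'_{k,2})=(r'_k\cos\phi'_k,r'_k\sin\phi'_k)$ with $r_k,r'_k\ge 0$ and $\phi_k,\phi'_k\in\mathbb{R}$ for $k=1,\dots,K$, and put $R^2=\max\big(\sum_{k=1}^K r_k^2,\sum_{k=1}^K {r'_k}^2\big)$ and $\bar r=\max\big(\max_k r_k,\max_k r'_k\big)$. Then also $$D_{\mathrm{KL}}(p_\theta\|p_{\theta'})\le\frac{e^{R^2/(2\sigma^2)}}{4\sigma^4}\sum_{k=1}^K\big(r_k^2-{r'_k}^2\big)^2+\frac{3\bar r^2R^2e^{3R^2/(2\sigma^2)}}{2\sigma^6}\cdot\inf_{\alpha\in\mathbb{R}}\sum_{k=1}^K\Big[(r_k-r'_k)^2+r_kr'_k\,(\phi_k-\phi'_k+k\alpha)^2\Big].$$ -/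

import Mathlib

open MeasureTheory InformationTheory

noncomputable section

/-- The rotation `θ ↦ g(α) · θ` of Fourier coefficients `θ ∈ ℝ^{2K}`. Coordinates are indexed by
`Fin K × Fin 2`; the index `i : Fin K` stands for the Fourier frequency `k = i + 1`, and
`θ (i, 0)`, `θ (i, 1)` are `θ_{k,1}`, `θ_{k,2}`. -/
def mraRot {K : ℕ} (α : ℝ) (θ : EuclideanSpace ℝ (Fin K × Fin 2)) :
    EuclideanSpace ℝ (Fin K × Fin 2) :=
  WithLp.toLp 2 fun p =>
    ![Real.cos (((p.1 : ℕ) + 1 : ℝ) * α) * θ (p.1, 0)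
        - Real.sin (((p.1 : ℕ) + 1 : ℝ) * α) * θ (p.1, 1),
      Real.sin (((p.1 : ℕ) + 1 : ℝ) * α) * θ (p.1, 0)
        + Real.cos (((p.1 : ℕ) + 1 : ℝ) * α) * θ (p.1, 1)] p.2

/-- The density `p_θ` on `ℝ^{2K}` of a sample `y = g(α) · θ + σ ε`, with `α` uniform on `[-π, π)`
and an independent standard Gaussian `ε ∈ ℝ^{2K}`: a Gaussian mixture over the rotations. -/
def mraDensity {K : ℕ} (σ : ℝ) (θ y : EuclideanSpace ℝ (Fin K × Fin 2)) : ℝ :=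
  (2 * Real.pi)⁻¹ * ∫ α in (-Real.pi)..Real.pi,
    ((2 * Real.pi * σ ^ 2) ^ K)⁻¹ * Real.exp (-‖y - mraRot α θ‖ ^ 2 / (2 * σ ^ 2))

/-- The distribution on `ℝ^{2K}` with Lebesgue density `p_θ`. -/
def mraLaw {K : ℕ} (σ : ℝ) (θ : EuclideanSpace ℝ (Fin K × Fin 2)) :
    Measure (EuclideanSpace ℝ (Fin K × Fin 2)) :=
  volume.withDensity fun y => ENNReal.ofReal (mraDensity σ θ y)

/-- `R² = max (∑ r_k², ∑ r'_k²)`. -/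
def maxEnergy {K : ℕ} (r r' : Fin K → ℝ) : ℝ :=
  max (∑ k, r k ^ 2) (∑ k, r' k ^ 2)

/-- `r̄ = max (max_k r_k, max_k r'_k)`. -/
def maxMagnitude {K : ℕ} (r r' : Fin K → ℝ) : ℝ :=
  max (⨆ k, r k) (⨆ k, r' k)

end

noncomputable section

/-! Both bounds rest on writing the divergence as the integral of the nonnegative function `q *
klFun (p / q)`. For the first bound, the two mixtures are coupled through the same angle. The
perspective of `klFun` is jointly convex, so the divergence is at most the average over α of the
divergences between the Gaussians centred at g(α)θ and g(α)θ'. Each of these equals ‖θ - θ'‖²/(2σ²),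
because rotations are isometries.

For the second bound, KL ≤ χ², and Jensen gives p_θ' ≥ exp(-‖θ'‖²/(2σ²)) g₀ with g₀ the centred
Gaussian, since a rotated vector averages to zero (`isoGauss_zero_mul_exp_le_mraDensity`). It
remains to bound ∫ (p_θ - p_θ')²/g₀, which is a combination of the kernels `rotKernel`, the averages
of exp(⟪θ, g(α)θ'⟫/σ²).

Expand the exponential. By orthogonality of characters, the m-th order contribution is a positive
multiple of ∑ |∏ c - ∏ c'|² over m-tuples of signed frequencies with sum zero, where c, c' are the
complex Fourier coefficients (`integral_inner_mraRot_pow_sub`). Orders 0 and 1 vanish, and order 2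
is exactly the power-spectrum term. From order 3 on, the zero-sum constraint fixes one index and so
replaces one factor of total energy by r̄² (`freqDist_add_two_le`); the tail is dominated by an
exponential series. Invariance of the law under rotating θ' then yields the infimum over alignments.
-/

/-! ### Rotations of Fourier coefficients. -/

theorem mraRot_apply_zero {K : ℕ} (α : ℝ) (θ : EuclideanSpace ℝ (Fin K × Fin 2)) (k : Fin K) :
    mraRot α θ (k, 0) = Real.cos (((k : ℕ) + 1 : ℝ) * α) * θ (k, 0)
      - Real.sin (((k : ℕ) + 1 : ℝ) * α) * θ (k, 1) := by
  simp [mraRot]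

theorem mraRot_apply_one {K : ℕ} (α : ℝ) (θ : EuclideanSpace ℝ (Fin K × Fin 2)) (k : Fin K) :
    mraRot α θ (k, 1) = Real.sin (((k : ℕ) + 1 : ℝ) * α) * θ (k, 0)
      + Real.cos (((k : ℕ) + 1 : ℝ) * α) * θ (k, 1) := by
  simp [mraRot]

theorem euclidean_pair_ext {K : ℕ} {x y : EuclideanSpace ℝ (Fin K × Fin 2)}
    (h₀ : ∀ k, x (k, 0) = y (k, 0)) (h₁ : ∀ k, x (k, 1) = y (k, 1)) : x = y := by
  ext ⟨k, j⟩
  fin_cases j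
  · exact h₀ k
  · exact h₁ k

theorem norm_sq_eq_sum_pair {K : ℕ} (x : EuclideanSpace ℝ (Fin K × Fin 2)) :
    ‖x‖ ^ 2 = ∑ k, (x (k, 0) ^ 2 + x (k, 1) ^ 2) := by
  rw [EuclideanSpace.real_norm_sq_eq, Fintype.sum_prod_type]
  simp

theorem inner_eq_sum_pair {K : ℕ} (x y : EuclideanSpace ℝ (Fin K × Fin 2)) :
    inner ℝ x y = ∑ k, (x (k, 0) * y (k, 0) + x (k, 1) * y (k, 1)) := by
  rw [PiLp.inner_apply, Fintype.sum_prod_type]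
  simp [mul_comm]

theorem mraRot_sub {K : ℕ} (α : ℝ) (x y : EuclideanSpace ℝ (Fin K × Fin 2)) :
    mraRot α x - mraRot α y = mraRot α (x - y) := by
  apply euclidean_pair_ext <;> intro k <;>
    simp only [mraRot_apply_zero, mraRot_apply_one, PiLp.sub_apply] <;> ring

theorem mraRot_mraRot {K : ℕ} (α β : ℝ) (x : EuclideanSpace ℝ (Fin K × Fin 2)) :
    mraRot α (mraRot β x) = mraRot (α + β) x := by
  apply euclidean_pair_ext <;> intro k <;>
    simp only [mraRot_apply_zero, mraRot_apply_one, mul_add, Real.cos_add, Real.sin_add] <;> ring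

theorem norm_mraRot {K : ℕ} (α : ℝ) (x : EuclideanSpace ℝ (Fin K × Fin 2)) :
    ‖mraRot α x‖ = ‖x‖ := by
  have h : ‖mraRot α x‖ ^ 2 = ‖x‖ ^ 2 := by
    simp only [norm_sq_eq_sum_pair, mraRot_apply_zero, mraRot_apply_one]
    refine Finset.sum_congr rfl fun k _ => ?_
    linear_combination (x (k, 0) ^ 2 + x (k, 1) ^ 2)
      * Real.sin_sq_add_cos_sq (((k : ℕ) + 1 : ℝ) * α)
  exact (sq_eq_sq₀ (norm_nonneg _) (norm_nonneg _)).1 h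

theorem inner_mraRot_mraRot {K : ℕ} (α β : ℝ) (x y : EuclideanSpace ℝ (Fin K × Fin 2)) :
    inner ℝ (mraRot α x) (mraRot β y) = inner ℝ x (mraRot (β - α) y) := by
  simp only [inner_eq_sum_pair, mraRot_apply_zero, mraRot_apply_one, mul_sub, Real.cos_sub,
    Real.sin_sub]
  exact Finset.sum_congr rfl fun k _ => by ring

theorem mraRot_periodic {K : ℕ} (x : EuclideanSpace ℝ (Fin K × Fin 2)) :
    Function.Periodic (fun α => mraRot α x) (2 * Real.pi) := by
  intro α
  have hc (k : Fin K) : Real.cos (((k : ℕ) + 1 : ℝ) * (α + 2 * Real.pi))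
      = Real.cos (((k : ℕ) + 1 : ℝ) * α) := by
    have := Real.cos_add_nat_mul_two_pi (((k : ℕ) + 1 : ℝ) * α) (k + 1)
    push_cast at this
    rw [mul_add, this]
  have hs (k : Fin K) : Real.sin (((k : ℕ) + 1 : ℝ) * (α + 2 * Real.pi))
      = Real.sin (((k : ℕ) + 1 : ℝ) * α) := by
    have := Real.sin_add_nat_mul_two_pi (((k : ℕ) + 1 : ℝ) * α) (k + 1)
    push_cast at this
    rw [mul_add, this]
  apply euclidean_pair_ext <;> intro k <;>
    simp only [mraRot_apply_zero, mraRot_apply_one, hc, hs]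

theorem continuous_mraRot {K : ℕ} (x : EuclideanSpace ℝ (Fin K × Fin 2)) :
    Continuous fun α => mraRot α x := by
  refine (PiLp.continuous_toLp 2 _).comp (continuous_pi ?_)
  rintro ⟨k, j⟩
  fin_cases j <;> simp <;> fun_prop

/-! ### Averaging over a uniform angle. -/

/-- The uniform probability measure on `(-π, π]`. -/
def angleUnif : Measure ℝ :=
  ENNReal.ofReal (2 * Real.pi)⁻¹ • volume.restrict (Set.Ioc (-Real.pi) Real.pi)

instance : IsProbabilityMeasure angleUnif := by
  constructor
  have h : Real.pi - -Real.pi = 2 * Real.pi := by ring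
  have : (2 * Real.pi)⁻¹ * (2 * Real.pi) = 1 := inv_mul_cancel₀ (by positivity)
  simp only [angleUnif, Measure.smul_apply, Measure.restrict_apply_univ, Real.volume_Ioc, h,
    smul_eq_mul]
  rw [← ENNReal.ofReal_mul (by positivity), this, ENNReal.ofReal_one]

theorem integral_angleUnif {F : Type*} [NormedAddCommGroup F] [NormedSpace ℝ F] (f : ℝ → F) :
    ∫ α, f α ∂angleUnif = (2 * Real.pi)⁻¹ • ∫ α in (-Real.pi)..Real.pi, f α := by
  rw [angleUnif, integral_smul_measure, intervalIntegral.integral_of_le (by linarith [Real.pi_pos]),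
    ENNReal.toReal_ofReal (by positivity)]

theorem integrable_angleUnif {F : Type*} [NormedAddCommGroup F] {f : ℝ → F}
    (hf : Continuous f) : Integrable f angleUnif := by
  refine Integrable.smul_measure ?_ ENNReal.ofReal_ne_top
  exact (hf.integrableOn_Icc).mono_set Set.Ioc_subset_Icc_self

theorem integral_angleUnif_add {F : Type*} [NormedAddCommGroup F] [NormedSpace ℝ F] {f : ℝ → F}
    (hf : Function.Periodic f (2 * Real.pi)) (β : ℝ) :
    ∫ α, f (α + β) ∂angleUnif = ∫ α, f α ∂angleUnif := by
  rw [integral_angleUnif, integral_angleUnif, intervalIntegral.integral_comp_add_right]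
  have h1 : Real.pi + β = (-Real.pi + β) + 2 * Real.pi := by ring
  have h2 := hf.intervalIntegral_add_eq (-Real.pi + β) (-Real.pi)
  rw [h1, h2]
  congr 3
  ring

/-! ### Gaussian densities and their mixtures over rotations. -/

/-- The density of the isotropic Gaussian on `ℝ^{2K}` with mean `a` and variance `σ²`. -/
def isoGauss {K : ℕ} (σ : ℝ) (a y : EuclideanSpace ℝ (Fin K × Fin 2)) : ℝ :=
  ((2 * Real.pi * σ ^ 2) ^ K)⁻¹ * Real.exp (-‖y - a‖ ^ 2 / (2 * σ ^ 2))

theorem isoGauss_pos {K : ℕ} {σ : ℝ} (hσ : 0 < σ) (a y : EuclideanSpace ℝ (Fin K × Fin 2)) :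
    0 < isoGauss σ a y := by
  unfold isoGauss
  positivity

theorem mraDensity_eq_integral {K : ℕ} (σ : ℝ) (θ y : EuclideanSpace ℝ (Fin K × Fin 2)) :
    mraDensity σ θ y = ∫ α, isoGauss σ (mraRot α θ) y ∂angleUnif := by
  rw [integral_angleUnif, mraDensity, smul_eq_mul]
  rfl

theorem continuous_isoGauss_mraRot {K : ℕ} (σ : ℝ) (θ : EuclideanSpace ℝ (Fin K × Fin 2)) :
    Continuous fun p : EuclideanSpace ℝ (Fin K × Fin 2) × ℝ =>
      isoGauss σ (mraRot p.2 θ) p.1 := by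
  have h : Continuous fun p : EuclideanSpace ℝ (Fin K × Fin 2) × ℝ => mraRot p.2 θ :=
    (continuous_mraRot θ).comp continuous_snd
  unfold isoGauss
  fun_prop

theorem continuous_isoGauss_mraRot_angle {K : ℕ} (σ : ℝ)
    (θ y : EuclideanSpace ℝ (Fin K × Fin 2)) :
    Continuous fun α => isoGauss σ (mraRot α θ) y := by
  have h := continuous_mraRot θ
  unfold isoGauss
  fun_prop

theorem integrable_isoGauss_mraRot {K : ℕ} (σ : ℝ) (θ y : EuclideanSpace ℝ (Fin K × Fin 2)) :
    Integrable (fun α => isoGauss σ (mraRot α θ) y) angleUnif :=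
  integrable_angleUnif (continuous_isoGauss_mraRot_angle σ θ y)

theorem mraDensity_pos {K : ℕ} {σ : ℝ} (hσ : 0 < σ) (θ y : EuclideanSpace ℝ (Fin K × Fin 2)) :
    0 < mraDensity σ θ y := by
  rw [mraDensity_eq_integral]
  refine (integral_pos_iff_support_of_nonneg (fun α => (isoGauss_pos hσ _ _).le)
    (integrable_isoGauss_mraRot σ θ y)).2 ?_
  have : Function.support (fun α => isoGauss σ (mraRot α θ) y) = Set.univ :=
    Set.eq_univ_of_forall fun α => (isoGauss_pos hσ _ _).ne'
  simp [this]

theorem continuous_mraDensity {K : ℕ} (σ : ℝ) (θ : EuclideanSpace ℝ (Fin K × Fin 2)) :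
    Continuous fun y => mraDensity σ θ y := by
  have := intervalIntegral.continuous_parametric_intervalIntegral_of_continuous' (μ := volume)
    (f := fun y α => isoGauss σ (mraRot α θ) y) (continuous_isoGauss_mraRot σ θ)
    (-Real.pi) Real.pi
  exact continuous_const.mul this

/-- Rotating θ only shifts the angle, and the mean of a periodic function over a full period ignores
shifts. This is what later permits an infimum over alignments. -/
theorem mraDensity_mraRot {K : ℕ} (σ β : ℝ) (θ y : EuclideanSpace ℝ (Fin K × Fin 2)) :
    mraDensity σ (mraRot β θ) y = mraDensity σ θ y := by
  simp only [mraDensity_eq_integral, mraRot_mraRot]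
  exact integral_angleUnif_add (f := fun α => isoGauss σ (mraRot α θ) y)
    (fun α => by simp only [mraRot_periodic θ α]) β

theorem mraLaw_mraRot {K : ℕ} (σ β : ℝ) (θ : EuclideanSpace ℝ (Fin K × Fin 2)) :
    mraLaw σ (mraRot β θ) = mraLaw σ θ := by
  simp only [mraLaw, mraDensity_mraRot]

theorem integrable_gauss_exp_inner {V : Type*} [NormedAddCommGroup V] [InnerProductSpace ℝ V]
    [FiniteDimensional ℝ V] [MeasurableSpace V] [BorelSpace V] {b : ℝ} (hb : 0 < b) (w : V) :
    Integrable fun v : V => Real.exp (-b * ‖v‖ ^ 2 + inner ℝ w v) := by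
  have h := GaussianFourier.integrable_cexp_neg_mul_sq_norm_add (b := (b : ℂ)) (V := V)
    (by simpa using hb) 1 w
  have h2 := h.re
  refine h2.congr (ae_of_all _ fun v => ?_)
  have : (-(b : ℂ) * (‖v‖ : ℂ) ^ 2 + 1 * (inner ℝ w v : ℝ))
      = ((-b * ‖v‖ ^ 2 + inner ℝ w v : ℝ) : ℂ) := by push_cast; ring
  simp only [this]
  rw [← Complex.ofReal_exp]
  exact RCLike.ofReal_re (K := ℂ) _

theorem integral_isoGauss_zero {K : ℕ} {σ : ℝ} (hσ : 0 < σ) :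
    ∫ y : EuclideanSpace ℝ (Fin K × Fin 2), isoGauss σ 0 y = 1 := by
  have hb : 0 < (2 * σ ^ 2)⁻¹ := by positivity
  have h := GaussianFourier.integral_rexp_neg_mul_sq_norm
    (V := EuclideanSpace ℝ (Fin K × Fin 2)) hb
  have h1 (y : EuclideanSpace ℝ (Fin K × Fin 2)) :
      -‖y - 0‖ ^ 2 / (2 * σ ^ 2) = -(2 * σ ^ 2)⁻¹ * ‖y‖ ^ 2 := by
    rw [sub_zero]; field_simp
  have h2 : (Module.finrank ℝ (EuclideanSpace ℝ (Fin K × Fin 2)) / 2 : ℝ) = (K : ℝ) := by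
    simp
  simp only [isoGauss, h1]
  rw [integral_const_mul, h, h2, Real.rpow_natCast, div_inv_eq_mul,
    show Real.pi * (2 * σ ^ 2) = 2 * Real.pi * σ ^ 2 by ring]
  exact inv_mul_cancel₀ (by positivity)

/-- The Gaussian density relative to the centred one. -/
theorem isoGauss_zero_mul_exp {K : ℕ} {σ : ℝ} (hσ : 0 < σ)
    (w y : EuclideanSpace ℝ (Fin K × Fin 2)) :
    isoGauss σ 0 y * Real.exp (inner ℝ w y)
      = ((2 * Real.pi * σ ^ 2) ^ K)⁻¹ * Real.exp (-(2 * σ ^ 2)⁻¹ * ‖y‖ ^ 2 + inner ℝ w y) := by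
  rw [isoGauss, mul_assoc, ← Real.exp_add, sub_zero]
  congr 3
  field_simp

theorem integrable_isoGauss_exp_inner {K : ℕ} {σ : ℝ} (hσ : 0 < σ)
    (w : EuclideanSpace ℝ (Fin K × Fin 2)) :
    Integrable fun y => isoGauss σ 0 y * Real.exp (inner ℝ w y) := by
  simp only [isoGauss_zero_mul_exp hσ]
  exact (integrable_gauss_exp_inner (by positivity) w).const_mul _

/-! ### Divergence of densities and convexity. -/

/-- Positivity of q makes p / q the Radon–Nikodym derivative. Since `klFun` is nonnegative where it
is used, the lower integral needs no integrability of the log-likelihood ratio and Tonelli applies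
to it. -/
theorem klDiv_withDensity_eq_lintegral {X : Type*} [MeasurableSpace X] {m : Measure X}
    {p q : X → ℝ} (hp : Measurable p) (hq : Measurable q)
    (hp0 : ∀ x, 0 < p x) (hq0 : ∀ x, 0 < q x)
    [IsFiniteMeasure (m.withDensity fun x => ENNReal.ofReal (p x))]
    [IsFiniteMeasure (m.withDensity fun x => ENNReal.ofReal (q x))] :
    klDiv (m.withDensity fun x => ENNReal.ofReal (p x))
        (m.withDensity fun x => ENNReal.ofReal (q x))
      = ∫⁻ x, ENNReal.ofReal (q x * klFun (p x / q x)) ∂m := by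
  set ν := m.withDensity fun x => ENNReal.ofReal (q x) with hν
  have hr : Measurable fun x => ENNReal.ofReal (p x / q x) := (hp.div hq).ennreal_ofReal
  have hμ : (m.withDensity fun x => ENNReal.ofReal (p x))
      = ν.withDensity fun x => ENNReal.ofReal (p x / q x) := by
    rw [hν, ← withDensity_mul m hq.ennreal_ofReal hr]
    congr 1
    funext x
    rw [Pi.mul_apply, ← ENNReal.ofReal_mul (hq0 x).le, mul_div_cancel₀ _ (hq0 x).ne']
  have hac : (m.withDensity fun x => ENNReal.ofReal (p x)) ≪ ν := by
    rw [hμ]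
    exact withDensity_absolutelyContinuous _ _
  rw [klDiv_eq_lintegral_klFun_of_ac hac]
  have hae : (m.withDensity fun x => ENNReal.ofReal (p x)).rnDeriv ν
      =ᵐ[ν] fun x => ENNReal.ofReal (p x / q x) := by
    rw [hμ]
    exact Measure.rnDeriv_withDensity ν hr
  have hm : Measurable fun x => ENNReal.ofReal (klFun (p x / q x)) :=
    (measurable_klFun.comp (hp.div hq)).ennreal_ofReal
  calc ∫⁻ x, ENNReal.ofReal
        (klFun ((m.withDensity fun x => ENNReal.ofReal (p x)).rnDeriv ν x).toReal) ∂ν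
      = ∫⁻ x, ENNReal.ofReal (klFun (p x / q x)) ∂ν := by
        refine lintegral_congr_ae ?_
        filter_upwards [hae] with x hx
        rw [hx, ENNReal.toReal_ofReal (div_pos (hp0 x) (hq0 x)).le]
    _ = _ := by
        rw [hν, lintegral_withDensity_eq_lintegral_mul _ hq.ennreal_ofReal hm]
        refine lintegral_congr fun x => ?_
        rw [Pi.mul_apply, ← ENNReal.ofReal_mul (hq0 x).le]

/-- The tangent-line form of convexity: the derivative of `klFun` is `Real.log`. -/
theorem klFun_ge_tangent {x t : ℝ} (hx : 0 < x) (ht : 0 < t) :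
    klFun t + Real.log t * (x - t) ≤ klFun x := by
  have h := Real.log_le_sub_one_of_pos (div_pos ht hx)
  rw [Real.log_div ht.ne' hx.ne'] at h
  have h2 := mul_le_mul_of_nonneg_left h hx.le
  have h3 : x * (t / x - 1) = t - x := by field_simp
  rw [h3] at h2
  simp only [klFun_apply]
  nlinarith

theorem klFun_le_sub_one_sq {x : ℝ} (hx : 0 < x) : klFun x ≤ (x - 1) ^ 2 := by
  have h := mul_le_mul_of_nonneg_left (Real.log_le_sub_one_of_pos hx) hx.le
  rw [klFun_apply]
  nlinarith

/-- Joint convexity of the perspective of `klFun`, for mixtures. -/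
theorem mul_klFun_integral_le {A : Type*} [MeasurableSpace A] {μ : Measure A}
    {p q : A → ℝ} (hp : Integrable p μ) (hq : Integrable q μ)
    (hp0 : ∀ a, 0 < p a) (hq0 : ∀ a, 0 < q a) (hP : 0 < ∫ a, p a ∂μ) (hQ : 0 < ∫ a, q a ∂μ)
    (hk : Integrable (fun a => q a * klFun (p a / q a)) μ) :
    (∫ a, q a ∂μ) * klFun ((∫ a, p a ∂μ) / ∫ a, q a ∂μ)
      ≤ ∫ a, q a * klFun (p a / q a) ∂μ := by
  set P := ∫ a, p a ∂μ with hPd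
  set Q := ∫ a, q a ∂μ with hQd
  have hd : Integrable (fun a => p a - P / Q * q a) μ := hp.sub (hq.const_mul _)
  have hlow : Integrable (fun a => klFun (P / Q) * q a
      + Real.log (P / Q) * (p a - P / Q * q a)) μ :=
    (hq.const_mul _).add (hd.const_mul _)
  -- Integrate the tangent inequality at P / Q, weighted by q; its linear part contributes P - (P /
  -- Q) Q = 0.
  calc Q * klFun (P / Q)
      = ∫ a, (klFun (P / Q) * q a + Real.log (P / Q) * (p a - P / Q * q a)) ∂μ := by
        rw [integral_add (hq.const_mul _) (hd.const_mul _),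
          integral_const_mul, integral_const_mul, integral_sub hp (hq.const_mul _),
          integral_const_mul, ← hPd, ← hQd, div_mul_cancel₀ _ hQ.ne']
        ring
    _ ≤ _ := by
        refine integral_mono hlow hk fun a => ?_
        have h := mul_le_mul_of_nonneg_left
          (klFun_ge_tangent (div_pos (hp0 a) (hq0 a)) (div_pos hP hQ)) (hq0 a).le
        have h2 : q a * (p a / q a) = p a := mul_div_cancel₀ _ (hq0 a).ne'
        calc _ = q a * klFun (P / Q) + Real.log (P / Q) * (q a * (p a / q a) - P / Q * q a) := by
              rw [h2]; ring
          _ ≤ _ := by linarith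

/-! ### Divergence between two isotropic Gaussians. -/

/-- Expanding the square exhibits every Gaussian as an exponential tilt of the centred one;
integrability questions and products of Gaussians reduce to this form. -/
theorem isoGauss_eq_zero_mul {K : ℕ} {σ : ℝ} (hσ : 0 < σ)
    (a y : EuclideanSpace ℝ (Fin K × Fin 2)) :
    isoGauss σ a y = Real.exp (-‖a‖ ^ 2 / (2 * σ ^ 2))
      * (isoGauss σ 0 y * Real.exp (inner ℝ ((σ ^ 2)⁻¹ • a) y)) := by
  rw [isoGauss_zero_mul_exp hσ, isoGauss, mul_left_comm, ← Real.exp_add, norm_sub_sq_real,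
    real_inner_smul_left, real_inner_comm]
  congr 2
  field_simp
  ring

theorem integrable_isoGauss {K : ℕ} {σ : ℝ} (hσ : 0 < σ)
    (a : EuclideanSpace ℝ (Fin K × Fin 2)) : Integrable fun y => isoGauss σ a y := by
  simp only [isoGauss_eq_zero_mul hσ a]
  exact (integrable_isoGauss_exp_inner hσ _).const_mul _

theorem integral_isoGauss {K : ℕ} {σ : ℝ} (hσ : 0 < σ)
    (a : EuclideanSpace ℝ (Fin K × Fin 2)) : ∫ y, isoGauss σ a y = 1 := by
  rw [← integral_isoGauss_zero (K := K) hσ, ← integral_sub_right_eq_self (isoGauss σ 0) a]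
  simp [isoGauss]

theorem lintegral_isoGauss {K : ℕ} {σ : ℝ} (hσ : 0 < σ)
    (a : EuclideanSpace ℝ (Fin K × Fin 2)) : ∫⁻ y, ENNReal.ofReal (isoGauss σ a y) = 1 := by
  rw [← ofReal_integral_eq_lintegral_ofReal (integrable_isoGauss hσ a)
    (ae_of_all _ fun y => (isoGauss_pos hσ a y).le), integral_isoGauss hσ, ENNReal.ofReal_one]

theorem integrable_isoGauss_mul_inner {K : ℕ} {σ : ℝ} (hσ : 0 < σ)
    (a w : EuclideanSpace ℝ (Fin K × Fin 2)) :
    Integrable fun y => isoGauss σ a y * inner ℝ w y := by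
  have h1 := (integrable_isoGauss_exp_inner hσ ((σ ^ 2)⁻¹ • a + w)).const_mul
    (Real.exp (-‖a‖ ^ 2 / (2 * σ ^ 2)))
  have h2 := (integrable_isoGauss_exp_inner hσ ((σ ^ 2)⁻¹ • a - w)).const_mul
    (Real.exp (-‖a‖ ^ 2 / (2 * σ ^ 2)))
  refine (h1.add h2).mono' ?_ (ae_of_all _ fun y => ?_)
  · refine Continuous.aestronglyMeasurable ?_
    unfold isoGauss
    fun_prop
  -- A linear factor is dominated by two opposite exponential tilts.
  · have h : |(inner ℝ w y : ℝ)| ≤ Real.exp (inner ℝ w y) + Real.exp (-inner ℝ w y) := by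
      have e1 := Real.add_one_le_exp (inner ℝ w y : ℝ)
      have e2 := Real.add_one_le_exp (-inner ℝ w y : ℝ)
      have e3 := Real.exp_pos (inner ℝ w y : ℝ)
      have e4 := Real.exp_pos (-inner ℝ w y : ℝ)
      exact abs_le.2 ⟨by linarith, by linarith⟩
    rw [Pi.add_apply, norm_mul, Real.norm_of_nonneg (isoGauss_pos hσ a y).le, Real.norm_eq_abs]
    refine (mul_le_mul_of_nonneg_left h (isoGauss_pos hσ a y).le).trans_eq ?_
    rw [isoGauss_eq_zero_mul hσ a, inner_add_left, inner_sub_left, sub_eq_add_neg,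
      Real.exp_add, Real.exp_add]
    ring

/-- After translation to the centre, the integrand is odd. -/
theorem integral_isoGauss_mul_inner_sub {K : ℕ} {σ : ℝ}
    (a w : EuclideanSpace ℝ (Fin K × Fin 2)) :
    ∫ y, isoGauss σ a y * inner ℝ w (y - a) = 0 := by
  have h1 : ∫ y, isoGauss σ a y * inner ℝ w (y - a) = ∫ y, isoGauss σ 0 y * inner ℝ w y := by
    rw [← integral_sub_right_eq_self (fun y => isoGauss σ 0 y * inner ℝ w y) a]
    simp [isoGauss]
  have h2 : ∫ y, isoGauss σ 0 y * inner ℝ w y = -∫ y, isoGauss σ 0 y * inner ℝ w y := by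
    rw [← integral_neg, ← integral_neg_eq_self (fun y => isoGauss σ 0 y * inner ℝ w y)]
    simp [isoGauss]
  rw [h1]
  linarith

theorem isoGauss_mul_klFun_eq {K : ℕ} {σ : ℝ} (hσ : 0 < σ)
    (a b y : EuclideanSpace ℝ (Fin K × Fin 2)) :
    isoGauss σ b y * klFun (isoGauss σ a y / isoGauss σ b y)
      = ‖a - b‖ ^ 2 / (2 * σ ^ 2) * isoGauss σ a y
        + isoGauss σ a y * inner ℝ ((σ ^ 2)⁻¹ • (a - b)) (y - a)
        + isoGauss σ b y - isoGauss σ a y := by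
  have hb := isoGauss_pos hσ b y
  have hr : isoGauss σ a y / isoGauss σ b y
      = Real.exp (‖a - b‖ ^ 2 / (2 * σ ^ 2) + inner ℝ ((σ ^ 2)⁻¹ • (a - b)) (y - a)) := by
    rw [isoGauss, isoGauss, mul_div_mul_left _ _ (by positivity), ← Real.exp_sub]
    congr 1
    have h : y - b = (y - a) + (a - b) := by abel
    rw [h, norm_add_sq_real, real_inner_smul_left, real_inner_comm (y - a)]
    field_simp
    ring
  have h2 : isoGauss σ b y * (isoGauss σ a y / isoGauss σ b y) = isoGauss σ a y :=
    mul_div_cancel₀ _ hb.ne'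
  have h3 : Real.log (isoGauss σ a y / isoGauss σ b y)
      = ‖a - b‖ ^ 2 / (2 * σ ^ 2) + inner ℝ ((σ ^ 2)⁻¹ • (a - b)) (y - a) := by
    rw [hr, Real.log_exp]
  rw [klFun_apply, mul_sub, mul_add, ← mul_assoc, h2, h3]
  ring

/-- The log-ratio is affine in y: its constant part gives the value, its linear part integrates to
zero, and the two remaining densities cancel. -/
theorem lintegral_isoGauss_mul_klFun {K : ℕ} {σ : ℝ} (hσ : 0 < σ)
    (a b : EuclideanSpace ℝ (Fin K × Fin 2)) :
    ∫⁻ y, ENNReal.ofReal (isoGauss σ b y * klFun (isoGauss σ a y / isoGauss σ b y))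
      = ENNReal.ofReal (‖a - b‖ ^ 2 / (2 * σ ^ 2)) := by
  set w := (σ ^ 2)⁻¹ • (a - b) with hw
  have i0 : Integrable fun y => isoGauss σ a y * inner ℝ w (y - a) := by
    simp only [inner_sub_right, mul_sub]
    exact (integrable_isoGauss_mul_inner hσ a w).sub ((integrable_isoGauss hσ a).mul_const _)
  have ia := (integrable_isoGauss hσ a)
  have ib := (integrable_isoGauss hσ b)
  have i1 := ia.const_mul (‖a - b‖ ^ 2 / (2 * σ ^ 2))
  have i2 : Integrable fun y => ‖a - b‖ ^ 2 / (2 * σ ^ 2) * isoGauss σ a y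
      + isoGauss σ a y * inner ℝ w (y - a) := i1.add i0
  have i3 : Integrable fun y => ‖a - b‖ ^ 2 / (2 * σ ^ 2) * isoGauss σ a y
      + isoGauss σ a y * inner ℝ w (y - a) + isoGauss σ b y := i2.add ib
  have hint : Integrable fun y =>
      isoGauss σ b y * klFun (isoGauss σ a y / isoGauss σ b y) := by
    simp only [isoGauss_mul_klFun_eq hσ]
    exact i3.sub ia
  rw [← ofReal_integral_eq_lintegral_ofReal hint (ae_of_all _ fun y =>
    mul_nonneg (isoGauss_pos hσ b y).le
      (klFun_nonneg (div_pos (isoGauss_pos hσ a y) (isoGauss_pos hσ b y)).le))]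
  congr 1
  simp only [isoGauss_mul_klFun_eq hσ]
  rw [integral_sub i3 ia, integral_add i2 ib, integral_add i1 i0,
    integral_const_mul, integral_isoGauss_mul_inner_sub, integral_isoGauss hσ,
    integral_isoGauss hσ]
  ring

/-! ### The first bound, by convexity. -/

theorem ofReal_mraDensity {K : ℕ} {σ : ℝ} (hσ : 0 < σ)
    (θ y : EuclideanSpace ℝ (Fin K × Fin 2)) :
    ENNReal.ofReal (mraDensity σ θ y)
      = ∫⁻ α, ENNReal.ofReal (isoGauss σ (mraRot α θ) y) ∂angleUnif := by
  rw [mraDensity_eq_integral, ofReal_integral_eq_lintegral_ofReal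
    (integrable_isoGauss_mraRot σ θ y) (ae_of_all _ fun α => (isoGauss_pos hσ _ y).le)]

theorem isProbabilityMeasure_mraLaw {K : ℕ} {σ : ℝ} (hσ : 0 < σ)
    (θ : EuclideanSpace ℝ (Fin K × Fin 2)) : IsProbabilityMeasure (mraLaw σ θ) := by
  constructor
  rw [mraLaw, withDensity_apply _ MeasurableSet.univ, Measure.restrict_univ]
  simp only [ofReal_mraDensity hσ]
  rw [lintegral_lintegral_swap
    (continuous_isoGauss_mraRot σ θ).measurable.ennreal_ofReal.aemeasurable]
  simp [lintegral_isoGauss hσ]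

theorem klDiv_mraLaw_eq_lintegral {K : ℕ} {σ : ℝ} (hσ : 0 < σ)
    (θ θ' : EuclideanSpace ℝ (Fin K × Fin 2)) :
    klDiv (mraLaw σ θ) (mraLaw σ θ') = ∫⁻ y, ENNReal.ofReal
      (mraDensity σ θ' y * klFun (mraDensity σ θ y / mraDensity σ θ' y)) := by
  have h1 := isProbabilityMeasure_mraLaw hσ θ
  have h2 := isProbabilityMeasure_mraLaw hσ θ'
  unfold mraLaw at h1 h2 ⊢
  exact klDiv_withDensity_eq_lintegral (continuous_mraDensity σ θ).measurable
    (continuous_mraDensity σ θ').measurable (mraDensity_pos hσ θ) (mraDensity_pos hσ θ')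

theorem klDiv_mraLaw_le_norm_sub_sq {K : ℕ} {σ : ℝ} (hσ : 0 < σ)
    (θ θ' : EuclideanSpace ℝ (Fin K × Fin 2)) :
    klDiv (mraLaw σ θ) (mraLaw σ θ') ≤ ENNReal.ofReal (‖θ - θ'‖ ^ 2 / (2 * σ ^ 2)) := by
  rw [klDiv_mraLaw_eq_lintegral hσ]
  have hg := continuous_isoGauss_mraRot σ θ
  have hg' := continuous_isoGauss_mraRot σ θ'
  have hk := continuous_klFun
  have hF : Continuous fun p : EuclideanSpace ℝ (Fin K × Fin 2) × ℝ =>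
      isoGauss σ (mraRot p.2 θ') p.1
        * klFun (isoGauss σ (mraRot p.2 θ) p.1 / isoGauss σ (mraRot p.2 θ') p.1) :=
    hg'.mul (hk.comp (hg.div hg' fun p => (isoGauss_pos hσ _ _).ne'))
  have hF0 (y : EuclideanSpace ℝ (Fin K × Fin 2)) (α : ℝ) :
      0 ≤ isoGauss σ (mraRot α θ') y
        * klFun (isoGauss σ (mraRot α θ) y / isoGauss σ (mraRot α θ') y) :=
    mul_nonneg (isoGauss_pos hσ _ y).le
      (klFun_nonneg (div_pos (isoGauss_pos hσ _ y) (isoGauss_pos hσ _ y)).le)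
  have hFi (y : EuclideanSpace ℝ (Fin K × Fin 2)) : Integrable (fun α =>
      isoGauss σ (mraRot α θ') y
        * klFun (isoGauss σ (mraRot α θ) y / isoGauss σ (mraRot α θ') y)) angleUnif := by
    have h := continuous_isoGauss_mraRot_angle σ θ y
    have h' := continuous_isoGauss_mraRot_angle σ θ' y
    exact integrable_angleUnif
      (h'.mul (hk.comp (h.div h' fun p => (isoGauss_pos hσ _ _).ne')))
  calc _ ≤ ∫⁻ y, ∫⁻ α, ENNReal.ofReal (isoGauss σ (mraRot α θ') y
        * klFun (isoGauss σ (mraRot α θ) y / isoGauss σ (mraRot α θ') y)) ∂angleUnif := by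
        refine lintegral_mono fun y => ?_
        rw [← ofReal_integral_eq_lintegral_ofReal (hFi y) (ae_of_all _ (hF0 y))]
        refine ENNReal.ofReal_le_ofReal ?_
        have h1 := mraDensity_pos hσ θ y
        have h2 := mraDensity_pos hσ θ' y
        rw [mraDensity_eq_integral] at h1 h2
        rw [mraDensity_eq_integral, mraDensity_eq_integral]
        exact mul_klFun_integral_le (integrable_isoGauss_mraRot σ θ y)
          (integrable_isoGauss_mraRot σ θ' y) (fun α => isoGauss_pos hσ _ y)
          (fun α => isoGauss_pos hσ _ y) h1 h2 (hFi y)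
    _ = ∫⁻ α, (∫⁻ y, ENNReal.ofReal (isoGauss σ (mraRot α θ') y
        * klFun (isoGauss σ (mraRot α θ) y / isoGauss σ (mraRot α θ') y))) ∂angleUnif :=
        lintegral_lintegral_swap hF.measurable.ennreal_ofReal.aemeasurable
    _ = _ := by
        simp only [lintegral_isoGauss_mul_klFun hσ, mraRot_sub, norm_mraRot]
        simp

/-! ### Sums over tuples with prescribed total frequency. -/

section ConstrainedSums

variable {ι : Type*} [Fintype ι]

/-- The squared mass of the products `∏ⱼ c (κ j)` over tuples `κ` of total frequency `n`. -/
def freqMass (f : ι → ℤ) (c : ι → ℂ) (m : ℕ) (n : ℤ) : ℝ :=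
  ∑ κ : Fin m → ι, if ∑ j, f (κ j) = n then ‖∏ j, c (κ j)‖ ^ 2 else 0

/-- The squared distance between the products of `c` and of `c'` over tuples of total
frequency `n`. -/
def freqDist (f : ι → ℤ) (c c' : ι → ℂ) (m : ℕ) (n : ℤ) : ℝ :=
  ∑ κ : Fin m → ι, if ∑ j, f (κ j) = n then ‖∏ j, c (κ j) - ∏ j, c' (κ j)‖ ^ 2 else 0

theorem sum_fin_succ_fun {M : Type*} [AddCommMonoid M] (m : ℕ) (g : (Fin (m + 1) → ι) → M) :
    ∑ κ, g κ = ∑ p, ∑ κ : Fin m → ι, g (Fin.cons p κ) := by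
  rw [← Fintype.sum_prod_type' (f := fun p (κ : Fin m → ι) => g (Fin.cons p κ))]
  exact (Fintype.sum_equiv (Fin.consEquiv fun _ => ι) _ _ fun _ => rfl).symm

theorem freqMass_succ (f : ι → ℤ) (c : ι → ℂ) (m : ℕ) (n : ℤ) :
    freqMass f c (m + 1) n = ∑ p, ‖c p‖ ^ 2 * freqMass f c m (n - f p) := by
  rw [freqMass, sum_fin_succ_fun]
  refine Finset.sum_congr rfl fun p _ => ?_
  rw [freqMass, Finset.mul_sum]
  refine Finset.sum_congr rfl fun κ _ => ?_
  simp only [Fin.sum_univ_succ, Fin.prod_univ_succ, Fin.cons_zero, Fin.cons_succ, norm_mul,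
    mul_pow, mul_ite, mul_zero, eq_sub_iff_add_eq']

theorem freqMass_zero (f : ι → ℤ) (c : ι → ℂ) (n : ℤ) :
    freqMass f c 0 n = if n = 0 then 1 else 0 := by
  simp [freqMass, eq_comm]

/-- Injectivity leaves at most one nonzero term, so a single weight appears instead of the total
weight. This is the source of the factor r̄². -/
theorem sum_ite_freq_le {f : ι → ℤ} (hf : Function.Injective f) {w : ι → ℝ} {ρ : ℝ}
    (hρ : 0 ≤ ρ) (hw : ∀ p, w p ≤ ρ) (n : ℤ) : ∑ p, (if f p = n then w p else 0) ≤ ρ := by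
  classical
  by_cases h : ∃ p, f p = n
  · obtain ⟨p, rfl⟩ := h
    simp only [hf.eq_iff]
    simpa using hw p
  · push Not at h
    simpa [h] using hρ

/-- All indices but the last are free and cost T each; the last is determined by the total frequency
and costs ρ. -/
theorem freqMass_succ_le {f : ι → ℤ} (hf : Function.Injective f) {c : ι → ℂ} {ρ T : ℝ}
    (hρ : 0 ≤ ρ) (hT : 0 ≤ T) (hc : ∀ p, ‖c p‖ ^ 2 ≤ ρ) (hcT : ∑ p, ‖c p‖ ^ 2 ≤ T)
    (m : ℕ) (n : ℤ) : freqMass f c (m + 1) n ≤ ρ * T ^ m := by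
  induction m generalizing n with
  | zero =>
    rw [freqMass_succ]
    simpa [freqMass_zero, sub_eq_zero, eq_comm] using sum_ite_freq_le hf hρ hc n
  | succ m ih =>
    rw [freqMass_succ]
    calc _ ≤ ∑ p, ‖c p‖ ^ 2 * (ρ * T ^ m) :=
          Finset.sum_le_sum fun p _ => mul_le_mul_of_nonneg_left (ih _) (by positivity)
      _ = (∑ p, ‖c p‖ ^ 2) * (ρ * T ^ m) := by rw [Finset.sum_mul]
      _ ≤ T * (ρ * T ^ m) := mul_le_mul_of_nonneg_right hcT (by positivity)
      _ = _ := by ring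

theorem freqDist_zero (f : ι → ℤ) (c c' : ι → ℂ) (n : ℤ) : freqDist f c c' 0 n = 0 := by
  simp [freqDist]

theorem freqDist_one (f : ι → ℤ) (c c' : ι → ℂ) (n : ℤ) :
    freqDist f c c' 1 n = ∑ p, if f p = n then ‖c p - c' p‖ ^ 2 else 0 := by
  rw [freqDist, sum_fin_succ_fun]
  simp

theorem norm_add_sq_le_weighted {E : Type*} [SeminormedAddCommGroup E] (x y : E) {t : ℝ}
    (ht : 0 < t) : ‖x + y‖ ^ 2 ≤ (1 + t⁻¹) * ‖x‖ ^ 2 + (1 + t) * ‖y‖ ^ 2 := by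
  have h1 : ‖x + y‖ ^ 2 ≤ (‖x‖ + ‖y‖) ^ 2 :=
    pow_le_pow_left₀ (norm_nonneg _) (norm_add_le x y) 2
  have h2 : (1 + t⁻¹) * ‖x‖ ^ 2 + (1 + t) * ‖y‖ ^ 2 - (‖x‖ + ‖y‖) ^ 2
      = t⁻¹ * (‖x‖ - t * ‖y‖) ^ 2 := by
    field_simp
    ring
  have h3 : 0 ≤ t⁻¹ * (‖x‖ - t * ‖y‖) ^ 2 := by positivity
  linarith

/-- Telescoping: cP - c'P' = c(P - P') + (c - c')P', followed by a weighted AM–GM. The weight t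
stays free for the induction to choose. -/
theorem freqDist_succ_le (f : ι → ℤ) (c c' : ι → ℂ) (m : ℕ) (n : ℤ) {t : ℝ} (ht : 0 < t) :
    freqDist f c c' (m + 1) n
      ≤ (1 + t⁻¹) * ∑ p, ‖c p‖ ^ 2 * freqDist f c c' m (n - f p)
        + (1 + t) * ∑ p, ‖c p - c' p‖ ^ 2 * freqMass f c' m (n - f p) := by
  rw [freqDist, sum_fin_succ_fun, Finset.mul_sum, Finset.mul_sum, ← Finset.sum_add_distrib]
  refine Finset.sum_le_sum fun p _ => ?_
  rw [freqDist, freqMass, Finset.mul_sum, Finset.mul_sum, Finset.mul_sum, Finset.mul_sum,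
    ← Finset.sum_add_distrib]
  refine Finset.sum_le_sum fun κ _ => ?_
  simp only [Fin.sum_univ_succ, Fin.prod_univ_succ, Fin.cons_zero, Fin.cons_succ,
    eq_sub_iff_add_eq']
  split_ifs
  · have h := norm_add_sq_le_weighted (c p * (∏ j, c (κ j) - ∏ j, c' (κ j)))
      ((c p - c' p) * ∏ j, c' (κ j)) ht
    rw [norm_mul, norm_mul, mul_pow, mul_pow] at h
    refine le_trans (le_of_eq ?_) h
    congr 2
    ring
  · simp

/-- Induction starts at length two: with a single index the constraint falls on the difference c -
c' itself, leaving no factor to bound by ρ. -/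
theorem freqDist_add_two_le {f : ι → ℤ} (hf : Function.Injective f) {c c' : ι → ℂ} {ρ T : ℝ}
    (hρ : 0 ≤ ρ) (hT : 0 ≤ T) (hc : ∀ p, ‖c p‖ ^ 2 ≤ ρ) (hc' : ∀ p, ‖c' p‖ ^ 2 ≤ ρ)
    (hcT : ∑ p, ‖c p‖ ^ 2 ≤ T) (hcT' : ∑ p, ‖c' p‖ ^ 2 ≤ T) (m : ℕ) (n : ℤ) :
    freqDist f c c' (m + 2) n
      ≤ ((m : ℝ) + 2) ^ 2 * ρ * T ^ m * ∑ p, ‖c p - c' p‖ ^ 2 := by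
  set D := ∑ p, ‖c p - c' p‖ ^ 2 with hD
  have hD0 : 0 ≤ D := Finset.sum_nonneg fun p _ => by positivity
  have hmass (m : ℕ) (n : ℤ) :
      ∑ p, ‖c p - c' p‖ ^ 2 * freqMass f c' (m + 1) (n - f p) ≤ D * (ρ * T ^ m) := by
    rw [hD, Finset.sum_mul]
    exact Finset.sum_le_sum fun p _ => mul_le_mul_of_nonneg_left
      (freqMass_succ_le hf hρ hT hc' hcT' m _) (by positivity)
  induction m generalizing n with
  | zero =>
    have h := freqDist_succ_le f c c' 1 n one_pos
    -- Exchange the sums so that, for each index of the difference, the constraint pins the other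
    -- index.
    have h1 : ∑ p, ‖c p‖ ^ 2 * freqDist f c c' 1 (n - f p) ≤ D * ρ := by
      calc ∑ p, ‖c p‖ ^ 2 * freqDist f c c' 1 (n - f p)
          = ∑ q, ‖c q - c' q‖ ^ 2 * ∑ p, if f p = n - f q then ‖c p‖ ^ 2 else 0 := by
            simp only [freqDist_one, Finset.mul_sum]
            rw [Finset.sum_comm]
            refine Finset.sum_congr rfl fun q _ => Finset.sum_congr rfl fun p _ => ?_
            have : f q = n - f p ↔ f p = n - f q := by omega
            simp only [this]
            split_ifs <;> ring
        _ ≤ ∑ q, ‖c q - c' q‖ ^ 2 * ρ :=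
            Finset.sum_le_sum fun q _ => mul_le_mul_of_nonneg_left
              (sum_ite_freq_le hf hρ hc _) (by positivity)
        _ = D * ρ := by rw [← Finset.sum_mul]
    have h2 := hmass 0 n
    norm_num at h h2 ⊢
    linarith
  | succ m ih =>
    -- The weight t = m + 2 closes the induction exactly: (1 + 1/(m+2))(m+2)² + (m+3) = (m+3)².
    have ht : (0 : ℝ) < (m : ℝ) + 2 := by positivity
    have h := freqDist_succ_le f c c' (m + 2) n ht
    have h1 : ∑ p, ‖c p‖ ^ 2 * freqDist f c c' (m + 2) (n - f p)
        ≤ T * (((m : ℝ) + 2) ^ 2 * ρ * T ^ m * D) := by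
      calc _ ≤ ∑ p, ‖c p‖ ^ 2 * (((m : ℝ) + 2) ^ 2 * ρ * T ^ m * D) :=
            Finset.sum_le_sum fun p _ => mul_le_mul_of_nonneg_left (ih _) (by positivity)
        _ = (∑ p, ‖c p‖ ^ 2) * (((m : ℝ) + 2) ^ 2 * ρ * T ^ m * D) := by rw [Finset.sum_mul]
        _ ≤ _ := mul_le_mul_of_nonneg_right hcT (by positivity)
    have h2 := hmass (m + 1) n
    calc freqDist f c c' (m + 1 + 2) n
        ≤ (1 + ((m : ℝ) + 2)⁻¹) * (T * (((m : ℝ) + 2) ^ 2 * ρ * T ^ m * D))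
          + (1 + ((m : ℝ) + 2)) * (D * (ρ * T ^ (m + 1))) :=
          h.trans (add_le_add (mul_le_mul_of_nonneg_left h1 (by positivity))
            (mul_le_mul_of_nonneg_left h2 (by positivity)))
      _ = _ := by
          push_cast
          field_simp
          ring

end ConstrainedSums

/-! ### Fourier coordinates and angular moments. -/

/-- Signed frequencies `±k`, `k = 1, …, K`. -/
def signedFreq {K : ℕ} (p : Fin K × Bool) : ℤ := if p.2 then (p.1 : ℤ) + 1 else -((p.1 : ℤ) + 1)

theorem signedFreq_injective {K : ℕ} : Function.Injective (signedFreq (K := K)) := by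
  rintro ⟨k, b⟩ ⟨l, b'⟩ h
  cases b <;> cases b' <;> simp [signedFreq, Prod.ext_iff, Fin.ext_iff] at h ⊢ <;> omega

theorem signedFreq_ne_zero {K : ℕ} (p : Fin K × Bool) : signedFreq p ≠ 0 := by
  obtain ⟨k, b⟩ := p
  cases b <;> simp only [signedFreq, if_true, Bool.false_eq_true, if_false] <;> omega

/-- Complex Fourier coefficients at the signed frequencies. -/
def fourierCoord {K : ℕ} (θ : EuclideanSpace ℝ (Fin K × Fin 2)) (p : Fin K × Bool) : ℂ :=
  if p.2 then ⟨θ (p.1, 0), θ (p.1, 1)⟩ else ⟨θ (p.1, 0), -θ (p.1, 1)⟩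

theorem norm_fourierCoord_sq {K : ℕ} (θ : EuclideanSpace ℝ (Fin K × Fin 2)) (p : Fin K × Bool) :
    ‖fourierCoord θ p‖ ^ 2 = θ (p.1, 0) ^ 2 + θ (p.1, 1) ^ 2 := by
  obtain ⟨k, b⟩ := p
  rw [← Complex.normSq_eq_norm_sq]
  cases b <;> simp [fourierCoord, Complex.normSq_apply] <;> ring

theorem fourierCoord_sub {K : ℕ} (θ θ' : EuclideanSpace ℝ (Fin K × Fin 2)) (p : Fin K × Bool) :
    fourierCoord θ p - fourierCoord θ' p = fourierCoord (θ - θ') p := by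
  obtain ⟨k, b⟩ := p
  cases b <;> apply Complex.ext <;> simp [fourierCoord] <;> ring

theorem sum_norm_fourierCoord_sq {K : ℕ} (θ : EuclideanSpace ℝ (Fin K × Fin 2)) :
    ∑ p, ‖fourierCoord θ p‖ ^ 2 = 2 * ‖θ‖ ^ 2 := by
  simp only [norm_fourierCoord_sq, norm_sq_eq_sum_pair, Fintype.sum_prod_type, Finset.mul_sum]
  exact Finset.sum_congr rfl fun k _ => by simp; ring

/-- The terms at k and -k are complex conjugates whose common real part is the k-th block of the
inner product, hence the factor 1/2. -/
theorem inner_mraRot_eq_sum {K : ℕ} (α : ℝ) (θ θ' : EuclideanSpace ℝ (Fin K × Fin 2)) :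
    ((inner ℝ θ (mraRot α θ') : ℝ) : ℂ) = ∑ p, 2⁻¹ * ((starRingEnd ℂ) (fourierCoord θ p)
      * fourierCoord θ' p * Complex.exp (signedFreq p * Complex.I * α)) := by
  rw [inner_eq_sum_pair, Complex.ofReal_sum, Fintype.sum_prod_type]
  refine Finset.sum_congr rfl fun k _ => ?_
  have h1 : ((k : ℂ) + 1) * Complex.I * α = ((((k : ℕ) + 1 : ℝ) * α : ℝ) : ℂ) * Complex.I := by
    push_cast; ring
  have h2 : -((k : ℂ) + 1) * Complex.I * α
      = ((-(((k : ℕ) + 1 : ℝ) * α) : ℝ) : ℂ) * Complex.I := by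
    push_cast; ring
  rw [mraRot_apply_zero, mraRot_apply_one]
  simp only [Fintype.sum_bool, fourierCoord, signedFreq, if_true, Bool.false_eq_true, if_false,
    Int.cast_neg, Int.cast_add, Int.cast_natCast, Int.cast_one]
  rw [h1, h2]
  apply Complex.ext <;>
    simp only [Complex.add_re, Complex.add_im, Complex.mul_re, Complex.mul_im,
      Complex.exp_ofReal_mul_I_re, Complex.exp_ofReal_mul_I_im, Complex.conj_re, Complex.conj_im,
      Complex.ofReal_re, Complex.ofReal_im, Real.cos_neg, Real.sin_neg, Complex.inv_re,
      Complex.inv_im, Complex.re_ofNat, Complex.im_ofNat, Complex.normSq_ofNat] <;> ring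

theorem integral_angleUnif_exp (n : ℤ) :
    ∫ α : ℝ, Complex.exp (n * Complex.I * α) ∂angleUnif = if n = 0 then 1 else 0 := by
  split_ifs with h
  · simp [h]
  · have hn : (n : ℂ) * Complex.I ≠ 0 := by simp [h]
    rw [integral_angleUnif, integral_exp_mul_complex hn]
    have : Complex.exp (n * Complex.I * (Real.pi : ℝ))
        = Complex.exp (n * Complex.I * ((-Real.pi : ℝ) : ℂ)) := by
      rw [Complex.exp_eq_exp_iff_exists_int]
      exact ⟨n, by push_cast; ring⟩
    rw [this, sub_self, zero_div, smul_zero]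

/-- Expand the power over tuples; averaging over the angle kills every character of nonzero total
frequency. -/
theorem integral_inner_mraRot_pow {K : ℕ} (θ θ' : EuclideanSpace ℝ (Fin K × Fin 2)) (m : ℕ) :
    ((∫ α, (inner ℝ θ (mraRot α θ')) ^ m ∂angleUnif : ℝ) : ℂ)
      = (2⁻¹) ^ m * ∑ κ : Fin m → Fin K × Bool, if ∑ j, signedFreq (κ j) = 0 then
          (starRingEnd ℂ) (∏ j, fourierCoord θ (κ j)) * ∏ j, fourierCoord θ' (κ j) else 0 := by
  rw [← integral_complex_ofReal]
  have h (α : ℝ) : (((inner ℝ θ (mraRot α θ')) ^ m : ℝ) : ℂ)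
      = ∑ κ : Fin m → Fin K × Bool, (2⁻¹) ^ m * ((starRingEnd ℂ) (∏ j, fourierCoord θ (κ j))
        * ∏ j, fourierCoord θ' (κ j))
          * Complex.exp ((∑ j, signedFreq (κ j) : ℤ) * Complex.I * α) := by
    rw [Complex.ofReal_pow, inner_mraRot_eq_sum, Fintype.sum_pow]
    refine Finset.sum_congr rfl fun κ _ => ?_
    rw [Finset.prod_mul_distrib, Finset.prod_mul_distrib, Finset.prod_mul_distrib,
      ← Complex.exp_sum, map_prod, Int.cast_sum, Finset.sum_mul, Finset.sum_mul]
    simp [mul_assoc]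
  simp only [h]
  rw [integral_finsetSum _ fun κ _ => integrable_angleUnif (by fun_prop), Finset.mul_sum]
  refine Finset.sum_congr rfl fun κ _ => ?_
  rw [integral_const_mul, integral_angleUnif_exp]
  split_ifs <;> simp

theorem integral_inner_mraRot_pow_sub {K : ℕ} (θ θ' : EuclideanSpace ℝ (Fin K × Fin 2)) (m : ℕ) :
    (∫ α, (inner ℝ θ (mraRot α θ)) ^ m ∂angleUnif)
        - 2 * (∫ α, (inner ℝ θ (mraRot α θ')) ^ m ∂angleUnif)
        + ∫ α, (inner ℝ θ' (mraRot α θ')) ^ m ∂angleUnif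
      = (2⁻¹) ^ m * freqDist signedFreq (fourierCoord θ) (fourierCoord θ') m 0 := by
  have key (a b : ℂ) : ((starRingEnd ℂ) a * a - 2 * ((starRingEnd ℂ) a * b)
      + (starRingEnd ℂ) b * b).re = ‖a - b‖ ^ 2 := by
    rw [← Complex.normSq_eq_norm_sq, Complex.normSq_apply]
    simp
    ring
  have h2 : ((2 : ℂ)⁻¹) ^ m = (((2 : ℝ)⁻¹ ^ m : ℝ) : ℂ) := by push_cast; ring
  have hc (x y : EuclideanSpace ℝ (Fin K × Fin 2)) := integral_inner_mraRot_pow x y m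
  -- Individual cross terms need not be real; only their real parts enter |a - b|².
  rw [← Complex.ofReal_re (_ - _ + _)]
  push_cast [hc]
  rw [h2, mul_left_comm, ← mul_sub, ← mul_add, Complex.re_ofReal_mul, Finset.mul_sum,
    ← Finset.sum_sub_distrib, ← Finset.sum_add_distrib, Complex.re_sum, freqDist]
  congr 1
  refine Finset.sum_congr rfl fun κ _ => ?_
  split_ifs
  · exact key _ _
  · simp

theorem integral_inner_mraRot {K : ℕ} (θ θ' : EuclideanSpace ℝ (Fin K × Fin 2)) :
    ∫ α, inner ℝ θ (mraRot α θ') ∂angleUnif = 0 := by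
  have h := integral_inner_mraRot_pow θ θ' 1
  simp only [pow_one, Fin.sum_univ_one, signedFreq_ne_zero, if_false, Finset.sum_const_zero,
    mul_zero] at h
  exact_mod_cast h

theorem freqDist_signedFreq_one {K : ℕ} (c c' : Fin K × Bool → ℂ) :
    freqDist signedFreq c c' 1 0 = 0 := by
  rw [freqDist_one]
  simp [signedFreq_ne_zero]

/-- Zero-sum pairs are (p, -p), whose coefficient product is the squared modulus; each k occurs once
per sign, hence the factor 2. -/
theorem freqDist_fourierCoord_two {K : ℕ} (θ θ' : EuclideanSpace ℝ (Fin K × Fin 2)) :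
    freqDist signedFreq (fourierCoord θ) (fourierCoord θ') 2 0
      = 2 * ∑ k, ((θ (k, 0) ^ 2 + θ (k, 1) ^ 2) - (θ' (k, 0) ^ 2 + θ' (k, 1) ^ 2)) ^ 2 := by
  have hneg (p q : Fin K × Bool) : signedFreq p + signedFreq q = 0 ↔ q = (p.1, !p.2) := by
    have : signedFreq (p.1, !p.2) = -signedFreq p := by
      obtain ⟨k, b⟩ := p
      cases b <;> simp [signedFreq]
    rw [← signedFreq_injective.eq_iff, this]
    omega
  have hprod (x : EuclideanSpace ℝ (Fin K × Fin 2)) (p : Fin K × Bool) :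
      fourierCoord x p * fourierCoord x (p.1, !p.2)
        = ((x (p.1, 0) ^ 2 + x (p.1, 1) ^ 2 : ℝ) : ℂ) := by
    obtain ⟨k, b⟩ := p
    cases b <;> apply Complex.ext <;>
      simp only [fourierCoord, Complex.mul_re, Complex.mul_im, Complex.ofReal_re,
        Complex.ofReal_im, Bool.not_true, Bool.not_false, if_true, Bool.false_eq_true,
        if_false] <;> ring
  have h1 : freqDist signedFreq (fourierCoord θ) (fourierCoord θ') 2 0
      = ∑ z : (Fin K × Bool) × (Fin K × Bool), if signedFreq z.1 + signedFreq z.2 = 0 then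
        ‖fourierCoord θ z.1 * fourierCoord θ z.2
          - fourierCoord θ' z.1 * fourierCoord θ' z.2‖ ^ 2 else 0 := by
    refine Fintype.sum_equiv (finTwoArrowEquiv _) _ _ fun κ => ?_
    simp only [Fin.sum_univ_two, Fin.prod_univ_two, finTwoArrowEquiv_apply]
    rfl
  rw [h1, Fintype.sum_prod_type]
  simp only [hneg, Finset.sum_ite_eq', Finset.mem_univ, if_true, hprod, ← Complex.ofReal_sub,
    Complex.norm_real, Real.norm_eq_abs, sq_abs]
  rw [Fintype.sum_prod_type, Finset.mul_sum]
  exact Finset.sum_congr rfl fun k _ => by simp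

/-! ### Power series of the rotation kernel. -/

/-- The mean of `exp (⟪θ, g(α) θ'⟫ / σ²)` over a uniform angle. -/
def rotKernel {K : ℕ} (σ : ℝ) (θ θ' : EuclideanSpace ℝ (Fin K × Fin 2)) : ℝ :=
  ∫ α, Real.exp (inner ℝ θ (mraRot α θ') / σ ^ 2) ∂angleUnif

theorem hasSum_real_exp (x : ℝ) : HasSum (fun n : ℕ => x ^ n / (n.factorial : ℝ)) (Real.exp x) := by
  rw [Real.exp_eq_exp_ℝ]
  exact NormedSpace.expSeries_div_hasSum_exp x

/-- Cauchy–Schwarz bounds the terms uniformly in the angle by an exponential series, which justifies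
termwise integration. -/
theorem hasSum_rotKernel {K : ℕ} {σ : ℝ} (hσ : 0 < σ)
    (θ θ' : EuclideanSpace ℝ (Fin K × Fin 2)) :
    HasSum (fun m : ℕ => ((m.factorial : ℝ) * (σ ^ 2) ^ m)⁻¹
      * ∫ α, (inner ℝ θ (mraRot α θ')) ^ m ∂angleUnif) (rotKernel σ θ θ') := by
  have hcont := continuous_mraRot θ'
  have hint (m : ℕ) : Integrable
      (fun α => (inner ℝ θ (mraRot α θ') / σ ^ 2) ^ m / (m.factorial : ℝ)) angleUnif :=
    integrable_angleUnif (by fun_prop)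
  have hsum : Summable fun m : ℕ =>
      ∫ α, ‖(inner ℝ θ (mraRot α θ') / σ ^ 2) ^ m / (m.factorial : ℝ)‖ ∂angleUnif := by
    refine Summable.of_nonneg_of_le (fun m => integral_nonneg fun α => norm_nonneg _) (fun m => ?_)
      (Real.summable_pow_div_factorial (‖θ‖ * ‖θ'‖ / σ ^ 2))
    calc _ ≤ ∫ _ : ℝ, (‖θ‖ * ‖θ'‖ / σ ^ 2) ^ m / (m.factorial : ℝ) ∂angleUnif := by
          refine integral_mono (hint m).norm (integrable_const _) fun α => ?_
          have h := abs_real_inner_le_norm θ (mraRot α θ')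
          rw [norm_mraRot] at h
          simp only [norm_div, norm_pow, Real.norm_eq_abs, Nat.abs_cast, abs_of_pos hσ]
          gcongr
      _ = _ := by simp
  have h := hasSum_integral_of_summable_integral_norm hint hsum
  simp only [(hasSum_real_exp _).tsum_eq] at h
  refine h.congr_fun ?_
  intro m
  rw [← integral_const_mul]
  refine integral_congr_ae (ae_of_all _ fun α => ?_)
  simp only [div_pow]
  field_simp

theorem rotKernel_gap_le {K : ℕ} {σ ρ T : ℝ} (hσ : 0 < σ) (hρ : 0 ≤ ρ)
    {θ θ' : EuclideanSpace ℝ (Fin K × Fin 2)}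
    (h : ∀ k, θ (k, 0) ^ 2 + θ (k, 1) ^ 2 ≤ ρ) (h' : ∀ k, θ' (k, 0) ^ 2 + θ' (k, 1) ^ 2 ≤ ρ)
    (hT : ‖θ‖ ^ 2 ≤ T) (hT' : ‖θ'‖ ^ 2 ≤ T) :
    rotKernel σ θ θ - 2 * rotKernel σ θ θ' + rotKernel σ θ' θ'
      ≤ (∑ k, ((θ (k, 0) ^ 2 + θ (k, 1) ^ 2) - (θ' (k, 0) ^ 2 + θ' (k, 1) ^ 2)) ^ 2) / (4 * σ ^ 4)
        + 3 * ρ * T * Real.exp (T / σ ^ 2) / (4 * σ ^ 6) * ‖θ - θ'‖ ^ 2 := by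
  have hT0 : 0 ≤ T := (sq_nonneg _).trans hT
  set a : ℕ → ℝ := fun m => ((m.factorial : ℝ) * (σ ^ 2) ^ m)⁻¹ * ((2⁻¹) ^ m
    * freqDist signedFreq (fourierCoord θ) (fourierCoord θ') m 0) with ha
  have hsum : HasSum a (rotKernel σ θ θ - 2 * rotKernel σ θ θ' + rotKernel σ θ' θ') := by
    refine (((hasSum_rotKernel hσ θ θ).sub ((hasSum_rotKernel hσ θ θ').mul_left 2)).add
      (hasSum_rotKernel hσ θ' θ')).congr_fun fun m => ?_
    rw [ha]
    simp only
    rw [← integral_inner_mraRot_pow_sub]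
    ring
  -- Split off orders 0, 1, 2, which are computed exactly, and compare the rest with the series of
  -- exp(T/σ²).
  have htail := (hasSum_nat_add_iff' 3).2 hsum
  have hexp := (hasSum_real_exp (T / σ ^ 2)).mul_left (3 * ρ * T / (4 * σ ^ 6) * ‖θ - θ'‖ ^ 2)
  have hle := hasSum_le (fun j => ?_) htail hexp
  · have h3 : ∑ i ∈ Finset.range 3, a i = (∑ k, ((θ (k, 0) ^ 2 + θ (k, 1) ^ 2)
        - (θ' (k, 0) ^ 2 + θ' (k, 1) ^ 2)) ^ 2) / (4 * σ ^ 4) := by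
      simp only [Finset.sum_range_succ, Finset.sum_range_zero, ha, freqDist_zero,
        freqDist_signedFreq_one, freqDist_fourierCoord_two, mul_zero, zero_add, Nat.factorial_two]
      field_simp
      norm_num [mul_comm]
    rw [h3] at hle
    have : 3 * ρ * T * Real.exp (T / σ ^ 2) / (4 * σ ^ 6) * ‖θ - θ'‖ ^ 2
      = 3 * ρ * T / (4 * σ ^ 6) * ‖θ - θ'‖ ^ 2 * Real.exp (T / σ ^ 2) := by ring
    linarith
  -- Order j + 3 is length (j + 1) + 2. The energy bound is 2T because each frequency carries two
  -- signs.
  · have hb := freqDist_add_two_le signedFreq_injective hρ (by positivity : 0 ≤ 2 * T)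
      (c := fourierCoord θ) (c' := fourierCoord θ')
      (fun p => (norm_fourierCoord_sq θ p).trans_le (h p.1))
      (fun p => (norm_fourierCoord_sq θ' p).trans_le (h' p.1))
      ((sum_norm_fourierCoord_sq θ).trans_le (by linarith))
      ((sum_norm_fourierCoord_sq θ').trans_le (by linarith)) (j + 1) 0
    simp only [fourierCoord_sub, sum_norm_fourierCoord_sq] at hb
    -- The constant 3 is the value at j = 0, the largest, of 2(j+3)/((j+1)(j+2)).
    have hj : ((j : ℝ) + 3) * 2 ≤ 3 * ((j + 1) * (j + 2)) := by nlinarith [Nat.cast_nonneg (α := ℝ) j]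
    have hfac : ((j + 3).factorial : ℝ) = (j + 3) * (j + 2) * (j + 1) * j.factorial := by
      simp only [Nat.factorial_succ]; push_cast; ring
    have hf0 : (0 : ℝ) < j.factorial := by positivity
    calc a (j + 3)
        ≤ (((j + 3).factorial : ℝ) * (σ ^ 2) ^ (j + 3))⁻¹ * ((2⁻¹) ^ (j + 3)
          * ((((j + 1 : ℕ) : ℝ) + 2) ^ 2 * ρ * (2 * T) ^ (j + 1) * (2 * ‖θ - θ'‖ ^ 2))) := by
          simp only [ha]
          gcongr
      _ = (((j : ℝ) + 3) * 2) / ((j + 1) * (j + 2))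
          * (ρ * T / (4 * σ ^ 6) * ‖θ - θ'‖ ^ 2 * ((T / σ ^ 2) ^ j / j.factorial)) := by
          rw [hfac, mul_pow, inv_pow, div_pow, pow_add (σ ^ 2) j 3]
          push_cast
          field_simp
          ring
      _ ≤ 3 * (ρ * T / (4 * σ ^ 6) * ‖θ - θ'‖ ^ 2 * ((T / σ ^ 2) ^ j / j.factorial)) := by
          refine mul_le_mul_of_nonneg_right ?_ (by positivity)
          rwa [div_le_iff₀ (by positivity)]
      _ = _ := by ring

/-! ### Comparison with the χ²-type integral. -/

theorem isoGauss_mul_isoGauss_div {K : ℕ} {σ : ℝ} (hσ : 0 < σ)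
    (a b y : EuclideanSpace ℝ (Fin K × Fin 2)) :
    isoGauss σ a y * isoGauss σ b y / isoGauss σ 0 y
      = Real.exp (inner ℝ a b / σ ^ 2) * isoGauss σ (a + b) y := by
  have h0 := (isoGauss_pos hσ 0 y).ne'
  rw [isoGauss_eq_zero_mul hσ a, isoGauss_eq_zero_mul hσ b, isoGauss_eq_zero_mul hσ (a + b),
    smul_add, inner_add_left, Real.exp_add]
  have : Real.exp (-‖a + b‖ ^ 2 / (2 * σ ^ 2)) = Real.exp (-‖a‖ ^ 2 / (2 * σ ^ 2))
      * Real.exp (-‖b‖ ^ 2 / (2 * σ ^ 2)) * Real.exp (-(inner ℝ a b / σ ^ 2)) := by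
    rw [← Real.exp_add, ← Real.exp_add, norm_add_sq_real]
    congr 1
    field_simp
    ring
  rw [this, Real.exp_neg]
  field_simp

/-- By Tonelli, y can be integrated first, removing a normalised Gaussian. What remains depends only
on the difference of the two angles, so one angular average is trivial. -/
theorem lintegral_mraDensity_mul_div {K : ℕ} {σ : ℝ} (hσ : 0 < σ)
    (θ θ' : EuclideanSpace ℝ (Fin K × Fin 2)) :
    ∫⁻ y, ENNReal.ofReal (mraDensity σ θ y * mraDensity σ θ' y / isoGauss σ 0 y)
      = ENNReal.ofReal (rotKernel σ θ θ') := by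
  have hg := continuous_mraRot θ
  have hg' := continuous_mraRot θ'
  have hpt (y : EuclideanSpace ℝ (Fin K × Fin 2)) :
      ENNReal.ofReal (mraDensity σ θ y * mraDensity σ θ' y / isoGauss σ 0 y)
        = ∫⁻ z, ENNReal.ofReal (Real.exp (inner ℝ (mraRot z.1 θ) (mraRot z.2 θ') / σ ^ 2)
          * isoGauss σ (mraRot z.1 θ + mraRot z.2 θ') y) ∂(angleUnif.prod angleUnif) := by
    have m1 := (continuous_isoGauss_mraRot_angle σ θ y).measurable.ennreal_ofReal
    have m2 := (continuous_isoGauss_mraRot_angle σ θ' y).measurable.ennreal_ofReal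
    rw [div_eq_mul_inv, ENNReal.ofReal_mul (mul_pos (mraDensity_pos hσ θ y)
      (mraDensity_pos hσ θ' y)).le, ENNReal.ofReal_mul (mraDensity_pos hσ θ y).le,
      ofReal_mraDensity hσ, ofReal_mraDensity hσ,
      ← lintegral_prod_mul m1.aemeasurable m2.aemeasurable,
      ← lintegral_mul_const' _ _ ENNReal.ofReal_ne_top]
    refine lintegral_congr fun z => ?_
    rw [← isoGauss_mul_isoGauss_div hσ, div_eq_mul_inv, ENNReal.ofReal_mul
      (mul_pos (isoGauss_pos hσ _ y) (isoGauss_pos hσ _ y)).le,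
      ENNReal.ofReal_mul (isoGauss_pos hσ _ y).le]
  have hc : Continuous fun q : EuclideanSpace ℝ (Fin K × Fin 2) × (ℝ × ℝ) =>
      Real.exp (inner ℝ (mraRot q.2.1 θ) (mraRot q.2.2 θ') / σ ^ 2)
          * isoGauss σ (mraRot q.2.1 θ + mraRot q.2.2 θ') q.1 := by
    have e1 : Continuous fun q : EuclideanSpace ℝ (Fin K × Fin 2) × (ℝ × ℝ) => mraRot q.2.1 θ :=
      hg.comp (by fun_prop)
    have e2 : Continuous fun q : EuclideanSpace ℝ (Fin K × Fin 2) × (ℝ × ℝ) => mraRot q.2.2 θ' :=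
      hg'.comp (by fun_prop)
    unfold isoGauss
    fun_prop
  simp only [hpt]
  rw [lintegral_lintegral_swap hc.measurable.ennreal_ofReal.aemeasurable]
  simp only [ENNReal.ofReal_mul (Real.exp_pos _).le]
  have hin (z : ℝ × ℝ) : ∫⁻ y, ENNReal.ofReal
        (Real.exp (inner ℝ (mraRot z.1 θ) (mraRot z.2 θ') / σ ^ 2))
          * ENNReal.ofReal (isoGauss σ (mraRot z.1 θ + mraRot z.2 θ') y)
      = ENNReal.ofReal (Real.exp (inner ℝ (mraRot z.1 θ) (mraRot z.2 θ') / σ ^ 2)) := by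
    rw [lintegral_const_mul' _ _ ENNReal.ofReal_ne_top, lintegral_isoGauss hσ, mul_one]
  simp only [hin]
  have hm : Continuous fun z : ℝ × ℝ =>
      Real.exp (inner ℝ (mraRot z.1 θ) (mraRot z.2 θ') / σ ^ 2) := by
    have e1 : Continuous fun q : ℝ × ℝ => mraRot q.1 θ := hg.comp continuous_fst
    have e2 : Continuous fun q : ℝ × ℝ => mraRot q.2 θ' := hg'.comp continuous_snd
    fun_prop
  rw [lintegral_prod _ hm.measurable.ennreal_ofReal.aemeasurable]
  have hb (α : ℝ) : ∫⁻ β, ENNReal.ofReal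
      (Real.exp (inner ℝ (mraRot α θ) (mraRot β θ') / σ ^ 2)) ∂angleUnif
        = ENNReal.ofReal (rotKernel σ θ θ') := by
    rw [← ofReal_integral_eq_lintegral_ofReal (integrable_angleUnif (by fun_prop))
      (ae_of_all _ fun β => (Real.exp_pos _).le)]
    simp only [inner_mraRot_mraRot, sub_eq_add_neg]
    rw [integral_angleUnif_add (f := fun β => Real.exp (inner ℝ θ (mraRot β θ') / σ ^ 2))
      (fun β => by simp only [mraRot_periodic θ' β])]
    rfl
  simp [hb]

theorem integrable_mraDensity_mul_div {K : ℕ} {σ : ℝ} (hσ : 0 < σ)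
    (θ θ' : EuclideanSpace ℝ (Fin K × Fin 2)) :
    Integrable fun y => mraDensity σ θ y * mraDensity σ θ' y / isoGauss σ 0 y := by
  have h0 : Continuous fun y : EuclideanSpace ℝ (Fin K × Fin 2) => isoGauss σ 0 y := by
    unfold isoGauss
    fun_prop
  have hc : Continuous fun y => mraDensity σ θ y * mraDensity σ θ' y / isoGauss σ 0 y :=
    ((continuous_mraDensity σ θ).mul (continuous_mraDensity σ θ')).div h0
      fun y => (isoGauss_pos hσ 0 y).ne'
  refine (lintegral_ofReal_ne_top_iff_integrable hc.aestronglyMeasurable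
    (ae_of_all _ fun y => ?_)).1 ?_
  · exact (div_pos (mul_pos (mraDensity_pos hσ θ y) (mraDensity_pos hσ θ' y))
      (isoGauss_pos hσ 0 y)).le
  · rw [lintegral_mraDensity_mul_div hσ]
    exact ENNReal.ofReal_ne_top

theorem integral_mraDensity_mul_div {K : ℕ} {σ : ℝ} (hσ : 0 < σ)
    (θ θ' : EuclideanSpace ℝ (Fin K × Fin 2)) :
    ∫ y, mraDensity σ θ y * mraDensity σ θ' y / isoGauss σ 0 y = rotKernel σ θ θ' := by
  rw [integral_eq_lintegral_of_nonneg_ae (ae_of_all _ fun y =>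
    (div_pos (mul_pos (mraDensity_pos hσ θ y) (mraDensity_pos hσ θ' y))
      (isoGauss_pos hσ 0 y)).le) (integrable_mraDensity_mul_div hσ θ θ').aestronglyMeasurable,
    lintegral_mraDensity_mul_div hσ]
  exact ENNReal.toReal_ofReal (integral_nonneg fun α => (Real.exp_pos _).le)

/-- Jensen in the form exp x ≥ 1 + x: the linear term averages to zero because no frequency is zero.
-/
theorem isoGauss_zero_mul_exp_le_mraDensity {K : ℕ} {σ : ℝ} (hσ : 0 < σ)
    (θ y : EuclideanSpace ℝ (Fin K × Fin 2)) :
    isoGauss σ 0 y * Real.exp (-‖θ‖ ^ 2 / (2 * σ ^ 2)) ≤ mraDensity σ θ y := by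
  have hg := continuous_mraRot θ
  have hi : Integrable (fun α => inner ℝ y (mraRot α θ)) angleUnif :=
    integrable_angleUnif (by fun_prop)
  have h1 : ∫ α, isoGauss σ 0 y * Real.exp (-‖θ‖ ^ 2 / (2 * σ ^ 2))
      * (1 + (σ ^ 2)⁻¹ * inner ℝ y (mraRot α θ)) ∂angleUnif
      = isoGauss σ 0 y * Real.exp (-‖θ‖ ^ 2 / (2 * σ ^ 2)) := by
    rw [integral_const_mul, integral_add (integrable_const _) (hi.const_mul _),
      integral_const_mul, integral_inner_mraRot]
    simp
  rw [← h1, mraDensity_eq_integral]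
  refine integral_mono (integrable_angleUnif (by fun_prop)) (integrable_isoGauss_mraRot σ θ y)
    fun α => ?_
  simp only
  rw [isoGauss_eq_zero_mul hσ (mraRot α θ), norm_mraRot, real_inner_smul_left,
    real_inner_comm y]
  have h := Real.add_one_le_exp ((σ ^ 2)⁻¹ * inner ℝ y (mraRot α θ))
  have hpos := mul_pos (isoGauss_pos hσ 0 y) (Real.exp_pos (-‖θ‖ ^ 2 / (2 * σ ^ 2)))
  have h2 := mul_le_mul_of_nonneg_left h hpos.le
  linarith

/-- KL ≤ χ², with the denominator q replaced by its multiple-of-Gaussian lower bound; expanding (p -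
q)² gives the three kernels. -/
theorem klDiv_mraLaw_le_rotKernel_gap {K : ℕ} {σ : ℝ} (hσ : 0 < σ)
    (θ θ' : EuclideanSpace ℝ (Fin K × Fin 2)) :
    klDiv (mraLaw σ θ) (mraLaw σ θ') ≤ ENNReal.ofReal (Real.exp (‖θ'‖ ^ 2 / (2 * σ ^ 2))
      * (rotKernel σ θ θ - 2 * rotKernel σ θ θ' + rotKernel σ θ' θ')) := by
  set p := mraDensity σ θ
  set q := mraDensity σ θ'
  set g : EuclideanSpace ℝ (Fin K × Fin 2) → ℝ := isoGauss σ 0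
  set c := Real.exp (‖θ'‖ ^ 2 / (2 * σ ^ 2)) with hc
  have i1 : Integrable fun y => p y * p y / g y := integrable_mraDensity_mul_div hσ θ θ
  have i2 : Integrable fun y => p y * q y / g y := integrable_mraDensity_mul_div hσ θ θ'
  have i3 : Integrable fun y => q y * q y / g y := integrable_mraDensity_mul_div hσ θ' θ'
  have i4 : Integrable fun y => p y * p y / g y - 2 * (p y * q y / g y) := i1.sub (i2.const_mul 2)
  have i5 : Integrable fun y => p y * p y / g y - 2 * (p y * q y / g y) + q y * q y / g y :=
    i4.add i3
  have hsq (y : EuclideanSpace ℝ (Fin K × Fin 2)) :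
      p y * p y / g y - 2 * (p y * q y / g y) + q y * q y / g y = (p y - q y) ^ 2 / g y := by
    ring
  have hint : ∫ y, c * (p y * p y / g y - 2 * (p y * q y / g y) + q y * q y / g y)
      = c * (rotKernel σ θ θ - 2 * rotKernel σ θ θ' + rotKernel σ θ' θ') := by
    rw [integral_const_mul, integral_add i4 i3, integral_sub i1 (i2.const_mul 2),
      integral_const_mul, ← integral_mraDensity_mul_div hσ θ θ,
      ← integral_mraDensity_mul_div hσ θ θ', ← integral_mraDensity_mul_div hσ θ' θ']
  rw [klDiv_mraLaw_eq_lintegral hσ, ← hint, ofReal_integral_eq_lintegral_ofReal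
    (i5.const_mul c) (ae_of_all _ fun y => ?_)]
  · refine lintegral_mono fun y => ENNReal.ofReal_le_ofReal ?_
    have hp : 0 < p y := mraDensity_pos hσ θ y
    have hq : 0 < q y := mraDensity_pos hσ θ' y
    have hg : 0 < g y := isoGauss_pos hσ 0 y
    have hcp : 0 < c := Real.exp_pos _
    have hlow : g y ≤ c * q y := by
      have h := mul_le_mul_of_nonneg_left (isoGauss_zero_mul_exp_le_mraDensity hσ θ' y) hcp.le
      rw [mul_left_comm, hc, ← Real.exp_add] at h
      have e : ‖θ'‖ ^ 2 / (2 * σ ^ 2) + -‖θ'‖ ^ 2 / (2 * σ ^ 2) = 0 := by ring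
      rwa [e, Real.exp_zero, mul_one] at h
    change q y * klFun (p y / q y) ≤ _
    rw [hsq]
    calc q y * klFun (p y / q y) ≤ q y * (p y / q y - 1) ^ 2 :=
          mul_le_mul_of_nonneg_left (klFun_le_sub_one_sq (div_pos hp hq)) hq.le
      _ = (p y - q y) ^ 2 / q y := by field_simp
      _ ≤ c * ((p y - q y) ^ 2 / g y) := by
          rw [← mul_div_assoc, div_le_div_iff₀ hq hg]
          nlinarith [mul_le_mul_of_nonneg_left hlow (sq_nonneg (p y - q y))]
  · simp only [Pi.zero_apply, hsq]
    exact mul_nonneg (Real.exp_pos _).le (div_nonneg (sq_nonneg _) (isoGauss_pos hσ 0 y).le)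

/-! ### Polar coordinates. -/

/-- The left side equals (r - r')² + 2rr'(1 - cos(φ - ψ)), and 1 - cos x ≤ x²/2. -/
theorem polar_sub_sq_le {r r' : ℝ} (hr : 0 ≤ r) (hr' : 0 ≤ r') (φ ψ : ℝ) :
    (r * Real.cos φ - r' * Real.cos ψ) ^ 2 + (r * Real.sin φ - r' * Real.sin ψ) ^ 2
      ≤ (r - r') ^ 2 + r * r' * (φ - ψ) ^ 2 := by
  have h := Real.one_sub_sq_div_two_le_cos (x := φ - ψ)
  rw [Real.cos_sub] at h
  have h1 := mul_le_mul_of_nonneg_left h (mul_nonneg hr hr')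
  have h2 := Real.sin_sq_add_cos_sq φ
  have h3 := Real.sin_sq_add_cos_sq ψ
  have e : (r * Real.cos φ - r' * Real.cos ψ) ^ 2 + (r * Real.sin φ - r' * Real.sin ψ) ^ 2
      = r ^ 2 + r' ^ 2
        - 2 * (r * r' * (Real.cos φ * Real.cos ψ + Real.sin φ * Real.sin ψ)) := by
    linear_combination r ^ 2 * h2 + r' ^ 2 * h3
  rw [e]
  nlinarith

theorem polar_sq_add_sq (r φ : ℝ) : (r * Real.cos φ) ^ 2 + (r * Real.sin φ) ^ 2 = r ^ 2 := by
  linear_combination r ^ 2 * Real.sin_sq_add_cos_sq φ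

theorem le_maxMagnitude_left {K : ℕ} (r r' : Fin K → ℝ) (k : Fin K) : r k ≤ maxMagnitude r r' :=
  (le_ciSup (Set.finite_range r).bddAbove k).trans (le_max_left _ _)

theorem le_maxMagnitude_right {K : ℕ} (r r' : Fin K → ℝ) (k : Fin K) : r' k ≤ maxMagnitude r r' :=
  (le_ciSup (Set.finite_range r').bddAbove k).trans (le_max_right _ _)

/-- The second bound for an arbitrary alignment angle, in polar coordinates. -/
theorem klDiv_mraLaw_le_polar {K : ℕ} {σ : ℝ} (hσ : 0 < σ)
    {θ θ' : EuclideanSpace ℝ (Fin K × Fin 2)} {r φ r' φ' : Fin K → ℝ}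
    (hr : ∀ k, 0 ≤ r k) (hr' : ∀ k, 0 ≤ r' k)
    (hθ : ∀ k, θ (k, 0) = r k * Real.cos (φ k) ∧ θ (k, 1) = r k * Real.sin (φ k))
    (hθ' : ∀ k, θ' (k, 0) = r' k * Real.cos (φ' k) ∧ θ' (k, 1) = r' k * Real.sin (φ' k)) :
    klDiv (mraLaw σ θ) (mraLaw σ θ') ≤ ENNReal.ofReal
      (Real.exp (maxEnergy r r' / (2 * σ ^ 2)) / (4 * σ ^ 4) * ∑ k, (r k ^ 2 - r' k ^ 2) ^ 2
        + 3 * maxMagnitude r r' ^ 2 * maxEnergy r r'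
            * Real.exp (3 * maxEnergy r r' / (2 * σ ^ 2)) / (2 * σ ^ 6)
          * ∑ k, ((r k - r' k) ^ 2 + r k * r' k * (φ k - φ' k) ^ 2)) := by
  set E := maxEnergy r r' with hE
  set M := maxMagnitude r r' with hM
  have hsq (k : Fin K) : θ (k, 0) ^ 2 + θ (k, 1) ^ 2 = r k ^ 2 := by
    rw [(hθ k).1, (hθ k).2, polar_sq_add_sq]
  have hsq' (k : Fin K) : θ' (k, 0) ^ 2 + θ' (k, 1) ^ 2 = r' k ^ 2 := by
    rw [(hθ' k).1, (hθ' k).2, polar_sq_add_sq]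
  have hn : ‖θ‖ ^ 2 ≤ E := by
    rw [norm_sq_eq_sum_pair, Finset.sum_congr rfl fun k _ => hsq k]
    exact le_max_left _ _
  have hn' : ‖θ'‖ ^ 2 ≤ E := by
    rw [norm_sq_eq_sum_pair, Finset.sum_congr rfl fun k _ => hsq' k]
    exact le_max_right _ _
  have hE0 : 0 ≤ E := (sq_nonneg _).trans hn
  have hgap := rotKernel_gap_le hσ (sq_nonneg M)
    (fun k => (hsq k).trans_le (pow_le_pow_left₀ (hr k) (le_maxMagnitude_left r r' k) 2))
    (fun k => (hsq' k).trans_le (pow_le_pow_left₀ (hr' k) (le_maxMagnitude_right r r' k) 2))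
    hn hn'
  simp only [hsq, hsq'] at hgap
  have hdist : ‖θ - θ'‖ ^ 2 ≤ ∑ k, ((r k - r' k) ^ 2 + r k * r' k * (φ k - φ' k) ^ 2) := by
    rw [norm_sq_eq_sum_pair]
    refine Finset.sum_le_sum fun k _ => ?_
    simp only [PiLp.sub_apply]
    rw [(hθ k).1, (hθ k).2, (hθ' k).1, (hθ' k).2]
    exact polar_sub_sq_le (hr k) (hr' k) _ _
  set S := ∑ k, (r k ^ 2 - r' k ^ 2) ^ 2
  set D := ∑ k, ((r k - r' k) ^ 2 + r k * r' k * (φ k - φ' k) ^ 2)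
  have hS : 0 ≤ S := Finset.sum_nonneg fun k _ => sq_nonneg _
  have hD : 0 ≤ D := (sq_nonneg _).trans hdist
  refine (klDiv_mraLaw_le_rotKernel_gap hσ θ θ').trans (ENNReal.ofReal_le_ofReal ?_)
  have hexp : Real.exp (3 * E / (2 * σ ^ 2))
      = Real.exp (E / (2 * σ ^ 2)) * Real.exp (E / σ ^ 2) := by
    rw [← Real.exp_add]
    congr 1
    field_simp
    ring
  calc _ ≤ Real.exp (‖θ'‖ ^ 2 / (2 * σ ^ 2))
        * (S / (4 * σ ^ 4) + 3 * M ^ 2 * E * Real.exp (E / σ ^ 2) / (4 * σ ^ 6) * ‖θ - θ'‖ ^ 2) :=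
        mul_le_mul_of_nonneg_left hgap (Real.exp_pos _).le
    -- Besides ‖θ'‖² ≤ E and the polar distance bound, this relaxes the denominator 4σ⁶ to 2σ⁶.
    _ ≤ Real.exp (E / (2 * σ ^ 2))
        * (S / (4 * σ ^ 4) + 3 * M ^ 2 * E * Real.exp (E / σ ^ 2) / (2 * σ ^ 6) * D) := by
        gcongr
        norm_num
    _ = _ := by
        rw [hexp]
        ring

end

/-! ### Assembly and optimisation over alignments. -/

theorem lemma12 (K : ℕ) (hK : 1 ≤ K) (σ : ℝ) (hσ : 0 < σ)
    (θ θ' : EuclideanSpace ℝ (Fin K × Fin 2)) :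
    klDiv (mraLaw σ θ) (mraLaw σ θ') ≤ ENNReal.ofReal (‖θ - θ'‖ ^ 2 / (2 * σ ^ 2)) ∧
    ∀ r φ r' φ' : Fin K → ℝ,
      (∀ k, 0 ≤ r k) → (∀ k, 0 ≤ r' k) →
      (∀ k, θ (k, 0) = r k * Real.cos (φ k) ∧ θ (k, 1) = r k * Real.sin (φ k)) →
      (∀ k, θ' (k, 0) = r' k * Real.cos (φ' k) ∧ θ' (k, 1) = r' k * Real.sin (φ' k)) →
      klDiv (mraLaw σ θ) (mraLaw σ θ') ≤ ENNReal.ofReal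
        (Real.exp (maxEnergy r r' / (2 * σ ^ 2)) / (4 * σ ^ 4)
            * ∑ k, (r k ^ 2 - r' k ^ 2) ^ 2
          + 3 * maxMagnitude r r' ^ 2 * maxEnergy r r'
              * Real.exp (3 * maxEnergy r r' / (2 * σ ^ 2)) / (2 * σ ^ 6)
            * ⨅ α : ℝ, ∑ k : Fin K,
                ((r k - r' k) ^ 2
                  + r k * r' k * (φ k - φ' k + ((k : ℕ) + 1 : ℝ) * α) ^ 2)) := by
  refine ⟨klDiv_mraLaw_le_norm_sub_sq hσ θ θ', fun r φ r' φ' hr hr' hθ hθ' => ?_⟩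
  have hE : 0 ≤ maxEnergy r r' :=
    (Finset.sum_nonneg fun k _ => sq_nonneg (r k)).trans (le_max_left _ _)
  -- Rotating θ' by -α leaves its law unchanged and lowers its k-th phase by kα.
  have hbound (α : ℝ) := klDiv_mraLaw_le_polar hσ (θ' := mraRot (-α) θ')
    (φ' := fun k => φ' k - ((k : ℕ) + 1 : ℝ) * α) hr hr' hθ fun k => by
      rw [mraRot_apply_zero, mraRot_apply_one, (hθ' k).1, (hθ' k).2, mul_neg, Real.cos_neg,
        Real.sin_neg, Real.cos_sub, Real.sin_sub]
      constructor <;> ring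
  -- Finiteness, from the first bound, allows a passage to real numbers; there the infimum can be
  -- tested at each α separately.
  have hfin : klDiv (mraLaw σ θ) (mraLaw σ θ') ≠ ⊤ :=
    ne_top_of_le_ne_top ENNReal.ofReal_ne_top (klDiv_mraLaw_le_norm_sub_sq hσ θ θ')
  rw [ENNReal.le_ofReal_iff_toReal_le hfin (by
    have : 0 ≤ ⨅ α : ℝ, ∑ k : Fin K, ((r k - r' k) ^ 2
        + r k * r' k * (φ k - φ' k + ((k : ℕ) + 1 : ℝ) * α) ^ 2) :=
      Real.iInf_nonneg fun α => Finset.sum_nonneg fun k _ =>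
        add_nonneg (sq_nonneg _) (mul_nonneg (mul_nonneg (hr k) (hr' k)) (sq_nonneg _))
    positivity), Real.mul_iInf_of_nonneg (by positivity), ← sub_le_iff_le_add']
  refine le_ciInf fun α => ?_
  rw [sub_le_iff_le_add']
  have h := hbound α
  rw [mraLaw_mraRot] at h
  simp only [sub_sub_eq_add_sub, add_sub_right_comm] at h
  refine ENNReal.toReal_le_of_le_ofReal ?_ h
  have : 0 ≤ ∑ k : Fin K, ((r k - r' k) ^ 2
      + r k * r' k * (φ k - φ' k + ((k : ℕ) + 1 : ℝ) * α) ^ 2) :=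
    Finset.sum_nonneg fun k _ =>
      add_nonneg (sq_nonneg _) (mul_nonneg (mul_nonneg (hr k) (hr' k)) (sq_nonneg _))
  positivity
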